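/- Let $A\in\mathbb R^{n\times n}$, $B\in\mathbb R^{n\times m}$, $C\in\mathbb R^{p\times n}$, $K\in\mathbb R^{m\times n}$, $L\in\mathbb R^{n\times p}$ be such that $A+BK$ and $A-LC$ are Hurwitz. Let $D_1,D_2:\mathbb R\to(0,\infty)$ be delay functions and $\phi_i(t)=t-D_i(t)$, $i\in\{1,2\}$. Assume that each $\phi_i$ is continuous on $[0,\infty)$ and continuously differentiable on $(0,\infty)$, that there are constants $\pi_0^\ast,\pi_2^\ast>0$ with $t-\phi_i(t)\ge\pi_0^\ast$ and $\phi_i'(t)\ge\pi_2^\ast$ for all $t>0$, and that $\sup_{\nu\ge\phi_i^{-1}(0)}(\nu-\phi_i(\nu))$ and $\sup_{\nu\ge\phi_i^{-1}(0)}\phi_i'(\nu)$ are finite, where $\phi_i^{-1}$ is the inverse of $\phi_i$ on $[0,\infty)$. Let $\psi(t)=\phi_1^{-1}(t)-t$ for $t\ge0$ be the exact prediction horizon. Consider the plant $$\dot Z(t)=AZ(t)+BU(t-D_1(t)),\qquad Y(t)=CZ(t-D_2(t)),$$ in closed loop with the observer–predictor output-feedback law $$\dot\xi(t)=\phi_2'(t)\bigl[A\xi(t)+BU(\phi_1(\phi_2(t)))+L(Y(t)-C\xi(t))\bigr],$$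 $$\hat Z(t)=e^{A(t-\phi_2(t))}\xi(t)+\int_{\phi_2(t)}^te^{A(t-\tau)}BU(\phi_1(\tau))\,d\tau,$$ $$\hat P(t)=e^{A\psi(t)}\hat Z(t)+\int_t^{t+\psi(t)}e^{A(t+\psi(t)-s)}BU(\phi_1(s))\,ds,\qquad U(t)=K\hat P(t).$$ The initial data are $U$ on $[\phi_1(\phi_2(0)),0]$, $Z$ on $[\phi_2(0),0]$ and $\xi(0)\in\mathbb R^n$. Differential equations are understood in the Carathéodory sense (locally absolutely continuous solutions, equation a.e.). The equation for $Z$ holds on $[\phi_2(0),\infty)$, that is, the initial history of $Z$ is itself a plant trajectory driven by the input history; the equations for $Y$ and $\xi$ hold for $t\ge0$ and the control law for $t>0$. Then there exist constants $M,C_0>0$, depending only on the matrices and the delay functions, such that all solutions of the closed loop satisfy, for all $t\ge0$, $$\Gamma(t)\le Me^{-C_0t}\,\Gamma(0),\qquad \Gamma(t):=|Z(t)|^2+|Z(t)-\hat Z(t)|^2+\sup_{\phi_1(t)\le\tau\le t}|U(\tau)|^2 .$$ -/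

import Mathlib

open MeasureTheory Set
open scoped ENNReal

noncomputable section

namespace DelayPredictor

/-- A real square matrix is Hurwitz: all its complex eigenvalues have negative real part. -/
def IsHurwitz {n : ℕ} (M : Matrix (Fin n) (Fin n) ℝ) : Prop :=
  ∀ μ ∈ spectrum ℂ (M.map (algebraMap ℝ ℂ)), μ.re < 0

/-- The time stamp `φ(t) = t - D(t)` of a delay function `D`. -/
def phi (D : ℝ → ℝ) (t : ℝ) : ℝ := t - D t

/-- The inverse `φ⁻¹(t)` of `φ : [0, ∞) → ℝ`. Under the two assumptions below, `φ` is strictly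
increasing on `[0, ∞)` with range `[φ(0), ∞)`, which contains `[0, ∞)`. -/
def phiInv (D : ℝ → ℝ) (t : ℝ) : ℝ := Function.invFunOn (phi D) (Ici 0) t

/-- The exact prediction horizon `ψ(t) = φ⁻¹(t) - t`. -/
def horizon (D : ℝ → ℝ) (t : ℝ) : ℝ := phiInv D t - t

/-- Regularity of a delay function `D : ℝ → (0, ∞)`: `φ` is `C¹` on `(0, ∞)`
and continuous up to `t = 0`. -/
structure RegularDelay (D : ℝ → ℝ) : Prop where
  pos : ∀ t, 0 < D t
  contDiffOn : ContDiffOn ℝ 1 (phi D) (Ioi 0)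
  continuousOn : ContinuousOn (phi D) (Ici 0)

/-- The delay is bounded away from zero, and `sup_{ν ≥ φ⁻¹(0)} (ν - φ(ν))` is finite. -/
structure DelayPositiveBounded (D : ℝ → ℝ) : Prop where
  lower : ∃ π₀ > 0, ∀ t > 0, π₀ ≤ t - phi D t
  upper : BddAbove ((fun ν => ν - phi D ν) '' Ici (phiInv D 0))

/-- The derivative of `φ` is bounded away from zero, and `sup_{ν ≥ φ⁻¹(0)} φ'(ν)` is finite. -/
structure DelayInvertible (D : ℝ → ℝ) : Prop where
  lower : ∃ π₂ > 0, ∀ t > 0, π₂ ≤ deriv (phi D) t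
  upper : BddAbove (deriv (phi D) '' Ici (phiInv D 0))

/-- The data of the control problem: plant matrices `A, B, C`, feedback gain `K`, observer gain
`L`, input delay `D₁` and measurement delay `D₂`. -/
structure ControlSystem (n m p : ℕ) where
  A : Matrix (Fin n) (Fin n) ℝ
  B : Matrix (Fin n) (Fin m) ℝ
  C : Matrix (Fin p) (Fin n) ℝ
  K : Matrix (Fin m) (Fin n) ℝ
  L : Matrix (Fin n) (Fin p) ℝ
  D₁ : ℝ → ℝ
  D₂ : ℝ → ℝ

/-- `x` is a (Carathéodory) solution of `ẋ(t) = v(t)` on `[t₀, ∞)`: `v` is integrable on bounded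
intervals and `x` is its integral, that is, `x` is locally absolutely continuous on `[t₀, ∞)` with
`ẋ = v` almost everywhere. -/
def SolvesFrom {n : ℕ} (t₀ : ℝ) (x v : ℝ → EuclideanSpace ℝ (Fin n)) : Prop :=
  ∀ t ≥ t₀, IntervalIntegrable v volume t₀ t ∧ x t = x t₀ + ∫ s in t₀..t, v s

namespace ControlSystem

variable {n m p : ℕ} (S : ControlSystem n m p)

/-- `φ₁(t) = t - D₁(t)`. -/
def φ₁ : ℝ → ℝ := phi S.D₁

/-- `φ₂(t) = t - D₂(t)`. -/
def φ₂ : ℝ → ℝ := phi S.D₂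

/-- `ψ(t) = φ₁⁻¹(t) - t`. -/
def ψ : ℝ → ℝ := horizon S.D₁

/-- The vector `e^{A r} x`. -/
def flow (r : ℝ) (x : EuclideanSpace ℝ (Fin n)) : EuclideanSpace ℝ (Fin n) :=
  Matrix.toEuclideanLin (NormedSpace.exp (r • S.A)) x

/-- The current-state estimate
`Ẑ(t) = e^{A(t - φ₂(t))} ξ(t) + ∫_{φ₂(t)}^t e^{A(t - τ)} B U(φ₁(τ)) dτ`. -/
def Zhat (U : ℝ → EuclideanSpace ℝ (Fin m)) (ξ : ℝ → EuclideanSpace ℝ (Fin n)) (t : ℝ) :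
    EuclideanSpace ℝ (Fin n) :=
  S.flow (t - S.φ₂ t) (ξ t) +
    ∫ τ in (S.φ₂ t)..t, S.flow (t - τ) (Matrix.toEuclideanLin S.B (U (S.φ₁ τ)))

/-- The predictor, with the exact horizon `ψ`,
`P̂(t) = e^{A ψ(t)} Ẑ(t) + ∫_t^{t + ψ(t)} e^{A(t + ψ(t) - s)} B U(φ₁(s)) ds`. -/
def Phat (U : ℝ → EuclideanSpace ℝ (Fin m)) (ξ : ℝ → EuclideanSpace ℝ (Fin n)) (t : ℝ) :
    EuclideanSpace ℝ (Fin n) :=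
  S.flow (S.ψ t) (S.Zhat U ξ t) +
    ∫ s in t..(t + S.ψ t), S.flow (t + S.ψ t - s) (Matrix.toEuclideanLin S.B (U (S.φ₁ s)))

/-- `(Z, Y, U, ξ)` is a solution of the plant in closed loop with the exact output-feedback law.
The values of `Z` on `[φ₂(0), 0]`, of `U` up to time `0`, and `ξ(0)` are the initial data;
the plant equation also governs `Z` on the initial interval `[φ₂(0), 0]`. The control law is
imposed for `t > 0` only, so that `U(0)` may be either part of the initial data or given
by the law. -/
structure IsClosedLoopSolution (Z : ℝ → EuclideanSpace ℝ (Fin n)) (Y : ℝ → EuclideanSpace ℝ (Fin p))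
    (U : ℝ → EuclideanSpace ℝ (Fin m)) (ξ : ℝ → EuclideanSpace ℝ (Fin n)) : Prop where
  /-- `Ż(t) = A Z(t) + B U(t - D₁(t))` -/
  plant : SolvesFrom (S.φ₂ 0) Z fun t =>
    Matrix.toEuclideanLin S.A (Z t) + Matrix.toEuclideanLin S.B (U (t - S.D₁ t))
  /-- `Y(t) = C Z(t - D₂(t))` -/
  output : ∀ t ≥ 0, Y t = Matrix.toEuclideanLin S.C (Z (t - S.D₂ t))
  /-- `ξ'(t) = φ₂'(t) [A ξ(t) + B U(φ₁(φ₂(t))) + L (Y(t) - C ξ(t))]` -/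
  observer : SolvesFrom 0 ξ fun t =>
    deriv S.φ₂ t • (Matrix.toEuclideanLin S.A (ξ t) +
      Matrix.toEuclideanLin S.B (U (S.φ₁ (S.φ₂ t))) +
      Matrix.toEuclideanLin S.L (Y t - Matrix.toEuclideanLin S.C (ξ t)))
  /-- `U(t) = K P̂(t)` -/
  control : ∀ t > 0, U t = Matrix.toEuclideanLin S.K (S.Phat U ξ t)

/-- `Γ(t) = |Z(t)|² + |Z(t) - Ẑ(t)|² + sup_{φ₁(t) ≤ τ ≤ t} |U(τ)|²`, with values in `[0, ∞]`. -/
def Gam (Z : ℝ → EuclideanSpace ℝ (Fin n)) (U : ℝ → EuclideanSpace ℝ (Fin m))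
    (ξ : ℝ → EuclideanSpace ℝ (Fin n)) (t : ℝ) : ℝ≥0∞ :=
  ‖Z t‖ₑ ^ 2 + ‖Z t - S.Zhat U ξ t‖ₑ ^ 2 + ⨆ τ ∈ Icc (S.φ₁ t) t, ‖U τ‖ₑ ^ 2

end ControlSystem

end DelayPredictor

end

/-! The design is exact, so the closed loop is a cascade of two exponentially stable linear systems.
In the time variable `φ₂`, the delayed plant state and the observer are driven by the same input, so
the error `Z(φ₂ t) - ξ t` evolves exactly by `A - LC` (`observer_error`). `Ẑ` and the predictor
propagate `ξ` by the plant's own variation-of-constants formula with the true input. Hence `Z - Ẑ`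
is the flow of the observer error (`sub_Zhat`), and `U(t)` equals `K Z(φ₁⁻¹ t)` minus `K` applied to
a flow of `Z - Ẑ` (`control_eq`).

Once the feedback reaches the plant, at time `φ₁⁻¹(0)`, the plant is therefore `A + BK` forced by a
decaying error (`plant_sub_nominal`); before that, it is bounded by the data. Bounded delays cost
only constants, and the lower bound on `φ₂'` turns decay in `φ₂(t)` into decay in `t`. The bounds on
`Z` and `Z - Ẑ` then control `U`, and squaring gives `Γ`. -/

namespace DelayPredictor

/-! ### Exponential decay of Hurwitz semigroups. -/

section ExpDecay

open NormedSpace Filter Topology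

/-- If some power of `exp a` has norm less than one, then the semigroup generated by `a` decays
exponentially. -/
theorem exists_norm_exp_smul_le {𝔸 : Type*} [NormedRing 𝔸] [NormedAlgebra ℝ 𝔸] [CompleteSpace 𝔸]
    (a : 𝔸) {k : ℕ} (hk : 0 < k) (h : ‖exp a ^ k‖ < 1) :
    ∃ C > 0, ∃ c > 0, ∀ t ≥ (0 : ℝ), ‖exp (t • a)‖ ≤ C * Real.exp (-c * t) := by
  let _ : NormedAlgebra ℚ 𝔸 := NormedAlgebra.restrictScalars ℚ ℝ 𝔸
  have hcont : Continuous fun t : ℝ => exp (t • a) :=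
    NormedSpace.exp_continuous.comp (by fun_prop)
  obtain ⟨C₀, hC₀⟩ := (isCompact_Icc (a := (0 : ℝ)) (b := k)).exists_bound_of_continuousOn
    hcont.continuousOn
  have hk' : (0 : ℝ) < k := by exact_mod_cast hk
  -- The maximum with `1/2` keeps `q` positive, so that `log q` gives a genuine rate even if the
  -- power vanishes.
  set q : ℝ := max ‖exp a ^ k‖ (1 / 2) with hq
  have hq0 : 0 < q := lt_max_of_lt_right (by norm_num)
  have hq1 : q < 1 := max_lt h (by norm_num)
  have hlog : Real.log q < 0 := Real.log_neg hq0 hq1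
  refine ⟨(|C₀| + 1) * q⁻¹, by positivity, -Real.log q / k, by
    apply div_pos <;> linarith, fun t ht => ?_⟩
  set N := ⌊t / k⌋₊ with hN
  have hN1 : (N : ℝ) ≤ t / k := Nat.floor_le (by positivity)
  have hN2 : t / k < N + 1 := Nat.lt_floor_add_one _
  have hs0 : 0 ≤ t - N * k := by
    have := (le_div_iff₀ hk').1 hN1; linarith
  have hs1 : t - N * k ≤ k := by
    have := (div_lt_iff₀ hk').1 hN2; linarith
  have hsplit : exp (t • a) = exp ((t - N * k) • a) * (exp a ^ k) ^ N := by
    rw [← pow_mul, ← exp_nsmul, ← exp_add_of_commute]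
    · congr 1
      rw [← Nat.cast_smul_eq_nsmul ℝ (k * N) a, ← add_smul]
      congr 1; push_cast; ring
    · exact ((Commute.refl a).smul_left _).smul_right _
  have hpow : ‖exp ((t - N * k) • a) * (exp a ^ k) ^ N‖ ≤ (|C₀| + 1) * q ^ N := by
    -- The case `N = 0` is separate because the norm of `1` is not assumed to be at most `1`.
    rcases Nat.eq_zero_or_pos N with h0 | h0
    · have := hC₀ _ ⟨hs0, hs1⟩
      simp only [h0, pow_zero, mul_one] at this ⊢
      linarith [le_abs_self C₀]
    · refine (norm_mul_le _ _).trans ?_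
      gcongr
      · exact (hC₀ _ ⟨hs0, hs1⟩).trans (by linarith [le_abs_self C₀])
      · exact (norm_pow_le' _ h0).trans (by gcongr; exact le_max_left _ _)
  rw [hsplit]
  refine hpow.trans ?_
  rw [mul_assoc]
  gcongr
  -- The factor `q⁻¹` pays for the floor: `N ≥ t / k - 1`.
  have h1 : q⁻¹ * Real.exp (-(-Real.log q / k) * t) = Real.exp (Real.log q * (t / k - 1)) := by
    rw [mul_sub, Real.exp_sub, mul_one, Real.exp_log hq0,
      show -(-Real.log q / k) * t = Real.log q * (t / k) by ring, div_eq_inv_mul (Real.exp _) q]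
  rw [h1, ← Real.exp_log hq0, ← Real.exp_nat_mul, Real.exp_log hq0, Real.exp_le_exp]
  nlinarith

open scoped Matrix.Norms.Operator

variable {n : ℕ}

/-- Evaluation at `v` is linear, hence continuous in finite dimension, so it passes through the
exponential series. -/
theorem exp_mulVec_of_mulVec_eq {M : Matrix (Fin n) (Fin n) ℂ} {μ : ℂ} {v : Fin n → ℂ}
    (h : M.mulVec v = μ • v) : (exp M).mulVec v = exp μ • v := by
  have h1 : ∀ k : ℕ, (M ^ k).mulVec v = μ ^ k • v := by
    intro k
    induction k with
    | zero => simp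
    | succ k ih => rw [pow_succ, ← Matrix.mulVec_mulVec, h, Matrix.mulVec_smul, ih, smul_smul,
        pow_succ']
  let T : Matrix (Fin n) (Fin n) ℂ →ₗ[ℂ] (Fin n → ℂ) :=
    { toFun := fun N => N.mulVec v
      map_add' := fun _ _ => Matrix.add_mulVec _ _ _
      map_smul' := fun _ _ => Matrix.smul_mulVec _ _ _ }
  have hT : Continuous T := T.continuous_of_finiteDimensional
  have h2 : HasSum (fun k : ℕ => (k.factorial⁻¹ : ℂ) • M ^ k) (exp M) :=
    exp_series_hasSum_exp' M
  have h3 := h2.map T hT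
  have h4 : HasSum (fun k : ℕ => (k.factorial⁻¹ : ℂ) • μ ^ k) (exp μ) :=
    exp_series_hasSum_exp' μ
  have h5 := h4.smul_const v
  refine h3.unique ?_
  convert h5 using 2 with k
  simp [T, Matrix.smul_mulVec, h1, smul_smul]

/-- Spectral mapping for the matrix exponential. -/
theorem exists_mem_spectrum_of_mem_spectrum_exp {M : Matrix (Fin n) (Fin n) ℂ} {z : ℂ}
    (hz : z ∈ spectrum ℂ (exp M)) : ∃ μ ∈ spectrum ℂ M, z = exp μ := by
  rw [← Matrix.spectrum_toLin', ← Module.End.hasEigenvalue_iff_mem_spectrum] at hz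
  -- Since `M` commutes with `exp M`, it preserves the `z`-eigenspace of `exp M`. An eigenvector of
  -- `M` inside that eigenspace is common to both.
  have hcomm : Commute (Matrix.toLin' (exp M)) (Matrix.toLin' M) := by
    have h : Commute (exp M) M := ((Commute.refl M).exp_left)
    simp only [Commute, SemiconjBy, Module.End.mul_eq_comp, ← Matrix.toLin'_mul, h.eq]
  have hmaps := Module.End.mapsTo_genEigenspace_of_comm hcomm z 1
  have : Nontrivial (Module.End.eigenspace (Matrix.toLin' (exp M)) z) :=
    (Submodule.nontrivial_iff_ne_bot).2 hz
  obtain ⟨μ, hμ⟩ := Module.End.exists_eigenvalue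
    ((Matrix.toLin' M).restrict hmaps :
      Module.End ℂ (Module.End.eigenspace (Matrix.toLin' (exp M)) z))
  obtain ⟨⟨v, hv⟩, hvμ⟩ := hμ.exists_hasEigenvector
  have hv0 : v ≠ 0 := fun h => hvμ.2 (by simp [h])
  have hMv : M.mulVec v = μ • v := by
    exact congrArg Subtype.val hvμ.apply_eq_smul
  have hEv : (exp M).mulVec v = z • v := by
    simpa using Module.End.mem_eigenspace_iff.1 hv
  refine ⟨μ, ?_, ?_⟩
  · rw [← Matrix.spectrum_toLin', ← Module.End.hasEigenvalue_iff_mem_spectrum]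
    exact Module.End.hasEigenvalue_of_hasEigenvector
      (Module.End.hasEigenvector_iff.2 ⟨Module.End.mem_eigenspace_iff.2 (by simpa using hMv), hv0⟩)
  · rw [exp_mulVec_of_mulVec_eq hMv] at hEv
    exact (smul_left_injective ℂ hv0 hEv).symm

/-- By spectral mapping and `|e^μ| = e^{Re μ}`, the spectral radius of `exp M` is below one;
Gelfand's formula turns this into a bound on some power. -/
theorem exists_norm_exp_pow_lt_one {M : Matrix (Fin n) (Fin n) ℂ}
    (hM : ∀ μ ∈ spectrum ℂ M, μ.re < 0) : ∃ k : ℕ, 0 < k ∧ ‖exp M ^ k‖ < 1 := by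
  have hrad : spectralRadius ℂ (exp M) < 1 := by
    rcases isEmpty_or_nonempty (Fin n) with hn | hn
    · have : Subsingleton (Matrix (Fin n) (Fin n) ℂ) := inferInstance
      simp [spectralRadius, spectrum.of_subsingleton]
    · have := spectrum.spectralRadius_lt_of_forall_lt (exp M) (r := 1) (fun z hz => by
        obtain ⟨μ, hμ, rfl⟩ := exists_mem_spectrum_of_mem_spectrum_exp hz
        rw [← NNReal.coe_lt_coe]
        rw [← Complex.exp_eq_exp_ℂ]
        simpa [Complex.norm_exp] using hM μ hμ)
      simpa using this
  have h1 := spectrum.pow_nnnorm_pow_one_div_tendsto_nhds_spectralRadius (exp M)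
  obtain ⟨k, hk, hk0⟩ := ((h1.eventually_lt_const hrad).and (eventually_gt_atTop 0)).exists
  refine ⟨k, hk0, ?_⟩
  have hk0' : (0 : ℝ) < 1 / k := by positivity
  by_contra! hge
  refine absurd hk (not_lt.2 (ENNReal.one_le_rpow ?_ hk0'))
  exact_mod_cast (show (1 : NNReal) ≤ ‖exp M ^ k‖₊ from hge)

theorem continuous_toEuclideanCLM :
    Continuous (Matrix.toEuclideanCLM (n := Fin n) (𝕜 := ℝ)) :=
  LinearMap.continuous_of_finiteDimensional
    (Matrix.toEuclideanCLM (n := Fin n) (𝕜 := ℝ)).toAlgEquiv.toLinearMap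

theorem toEuclideanCLM_exp (M : Matrix (Fin n) (Fin n) ℝ) :
    Matrix.toEuclideanCLM (𝕜 := ℝ) (exp M) = exp (Matrix.toEuclideanCLM (𝕜 := ℝ) M) :=
  map_exp _ continuous_toEuclideanCLM M

/-- The semigroup generated by a Hurwitz matrix decays exponentially. -/
theorem IsHurwitz.exists_norm_exp_le {M : Matrix (Fin n) (Fin n) ℝ} (hM : IsHurwitz M) :
    ∃ C > 0, ∃ c > 0, ∀ t ≥ (0 : ℝ),
      ‖exp (t • Matrix.toEuclideanCLM (𝕜 := ℝ) M)‖ ≤ C * Real.exp (-c * t) := by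
  obtain ⟨k, hk, hk1⟩ := exists_norm_exp_pow_lt_one hM
  obtain ⟨C, hC, c, hc, hdecay⟩ := exists_norm_exp_smul_le _ hk hk1
  -- Entrywise real part followed by the action on Euclidean space: a bounded real-linear map
  -- sending the complexified semigroup to the real one, so decay carries over.
  let Φ : Matrix (Fin n) (Fin n) ℂ →ₗ[ℝ]
      (EuclideanSpace ℝ (Fin n) →L[ℝ] EuclideanSpace ℝ (Fin n)) :=
    (Matrix.toEuclideanCLM (n := Fin n) (𝕜 := ℝ)).toAlgEquiv.toLinearMap ∘ₗ
      Complex.reLm.mapMatrix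
  have hΦ : ∀ t : ℝ, Φ (exp (t • M.map (algebraMap ℝ ℂ))) =
      exp (t • Matrix.toEuclideanCLM (𝕜 := ℝ) M) := by
    intro t
    have h1 : t • M.map (algebraMap ℝ ℂ) = (algebraMap ℝ ℂ).mapMatrix (t • M) := by
      ext i j; simp
    have h2 : (algebraMap ℝ ℂ).mapMatrix (exp (t • M)) = exp ((algebraMap ℝ ℂ).mapMatrix (t • M)) :=
      map_exp _ (Continuous.matrix_map continuous_id Complex.continuous_ofReal) _
    rw [h1, ← h2, ← map_smul, ← toEuclideanCLM_exp]
    change Matrix.toEuclideanCLM (𝕜 := ℝ) _ = _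
    congr 1
  obtain ⟨R, hR, hΦR⟩ := SemilinearMapClass.bound_of_continuous Φ Φ.continuous_of_finiteDimensional
  refine ⟨R * C, by positivity, c, hc, fun t ht => ?_⟩
  rw [← hΦ, mul_assoc]
  refine (hΦR _).trans ?_
  gcongr
  exact hdecay t ht

end ExpDecay

/-! ### Absolute continuity and variation of constants. -/

section VariationOfConstants

open NormedSpace Filter Topology

variable {E F : Type*} [NormedAddCommGroup E] [NormedSpace ℝ E]
  [NormedAddCommGroup F] [NormedSpace ℝ F]

theorem absolutelyContinuousOnInterval_of_dist_le {X Y : Type*} [PseudoMetricSpace X]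
    [PseudoMetricSpace Y] {f : ℝ → X} {g : ℝ → Y} {a b : ℝ}
    (hg : AbsolutelyContinuousOnInterval g a b)
    (h : ∀ s ∈ uIcc a b, ∀ t ∈ uIcc a b, dist (f s) (f t) ≤ dist (g s) (g t)) :
    AbsolutelyContinuousOnInterval f a b := by
  rw [absolutelyContinuousOnInterval_iff] at hg ⊢
  intro ε hε
  obtain ⟨δ, hδ, H⟩ := hg ε hε
  refine ⟨δ, hδ, fun I hI hIδ => (Finset.sum_le_sum fun i hi => ?_).trans_lt (H I hI hIδ)⟩
  exact h _ (hI.1 i hi).1 _ (hI.1 i hi).2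

/-- Increments are dominated by those of the scalar primitive of `‖f‖`. -/
theorem absolutelyContinuousOnInterval_integral {f : ℝ → E} {a b : ℝ}
    (hf : IntervalIntegrable f volume a b) :
    AbsolutelyContinuousOnInterval (fun t => ∫ s in a..t, f s) a b := by
  refine absolutelyContinuousOnInterval_of_dist_le
    (hf.norm.absolutelyContinuousOnInterval_intervalIntegral (c := a) (by simp)) ?_
  intro s hs t ht
  have hs' : IntervalIntegrable f volume a s := hf.mono_set (uIcc_subset_uIcc (by simp) hs)
  have ht' : IntervalIntegrable f volume a t := hf.mono_set (uIcc_subset_uIcc (by simp) ht)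
  rw [dist_eq_norm, dist_eq_norm, intervalIntegral.integral_interval_sub_left hs' ht',
    intervalIntegral.integral_interval_sub_left hs'.norm ht'.norm]
  exact intervalIntegral.norm_integral_le_abs_integral_norm

theorem absolutelyContinuousOnInterval_clm_apply {T : ℝ → E →L[ℝ] F} {x : ℝ → E} {a b : ℝ}
    (hT : AbsolutelyContinuousOnInterval T a b) (hx : AbsolutelyContinuousOnInterval x a b) :
    AbsolutelyContinuousOnInterval (fun t => T t (x t)) a b := by
  obtain ⟨C, hC⟩ := hT.exists_bound
  obtain ⟨D, hD⟩ := hx.exists_bound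
  have hlim : Tendsto (fun I : ℕ × (ℕ → ℝ × ℝ) =>
      C * ∑ i ∈ Finset.range I.1, dist (x (I.2 i).1) (x (I.2 i).2) +
      D * ∑ i ∈ Finset.range I.1, dist (T (I.2 i).1) (T (I.2 i).2))
      (AbsolutelyContinuousOnInterval.totalLengthFilter ⊓
        𝓟 (AbsolutelyContinuousOnInterval.disjWithin a b)) (𝓝 0) := by
    unfold AbsolutelyContinuousOnInterval at hx hT
    simpa using (hx.const_mul C).add (hT.const_mul D)
  refine squeeze_zero' (Eventually.of_forall fun _ => Finset.sum_nonneg fun _ _ => dist_nonneg)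
    ?_ hlim
  rw [eventually_inf_principal]
  filter_upwards with I hI
  simp only [Finset.mul_sum, ← Finset.sum_add_distrib]
  refine Finset.sum_le_sum fun i hi => ?_
  obtain ⟨h1, h2⟩ := hI.1 i hi
  set s := (I.2 i).1
  set t := (I.2 i).2
  have key : T s (x s) - T t (x t) = T s (x s - x t) + (T s - T t) (x t) := by
    simp
  rw [dist_eq_norm, dist_eq_norm, dist_eq_norm, key]
  refine (norm_add_le _ _).trans (add_le_add ?_ ?_)
  · exact ((T s).le_opNorm _).trans (by gcongr; exact hC s h1)
  · refine ((T s - T t).le_opNorm _).trans ?_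
    rw [mul_comm]
    gcongr
    exact hD t h2

theorem hasDerivAt_exp_sub_smul [CompleteSpace E] (L : E →L[ℝ] E) (b t : ℝ) :
    HasDerivAt (fun s : ℝ => exp ((b - s) • L)) (-(exp ((b - t) • L) * L)) t := by
  have h := (hasDerivAt_exp_smul_const L (b - t)).scomp t ((hasDerivAt_id t).const_sub b)
  simpa [Function.comp_def] using h

theorem continuous_exp_sub_smul [CompleteSpace E] (L : E →L[ℝ] E) (b : ℝ) :
    Continuous fun s : ℝ => exp ((b - s) • L) :=
  continuous_iff_continuousAt.2 fun t => (hasDerivAt_exp_sub_smul L b t).continuousAt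

theorem continuous_exp_smul [CompleteSpace E] (L : E →L[ℝ] E) :
    Continuous fun s : ℝ => exp (s • L) :=
  continuous_iff_continuousAt.2 fun t => (hasDerivAt_exp_smul_const L t).continuousAt

theorem exp_neg_smul_apply_exp_smul [CompleteSpace E] (L : E →L[ℝ] E) (r : ℝ) (x : E) :
    exp (-r • L) (exp (r • L) x) = x := by
  let _ : NormedAlgebra ℚ (E →L[ℝ] E) := NormedAlgebra.restrictScalars ℚ ℝ _
  have h := exp_add_of_commute (((Commute.refl L).smul_left (-r)).smul_right r)
  rw [← mul_apply_eq_comp, ← h, ← add_smul, neg_add_cancel, zero_smul, exp_zero,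
    one_apply_eq_self]

theorem intervalIntegrable_clm_apply {T : ℝ → E →L[ℝ] F} {g : ℝ → E} {a b : ℝ}
    (hT : Continuous T) (hg : IntervalIntegrable g volume a b) :
    IntervalIntegrable (fun s => T s (g s)) volume a b := by
  obtain ⟨C, hC⟩ := (isCompact_uIcc (a := a) (b := b)).exists_bound_of_continuousOn hT.continuousOn
  rw [intervalIntegrable_iff] at hg ⊢
  refine (hg.norm.const_mul C).mono'
    ((ContinuousLinearMap.apply ℝ F).flip.aestronglyMeasurable_comp₂
      hT.aestronglyMeasurable hg.aestronglyMeasurable) ?_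
  filter_upwards [ae_restrict_mem measurableSet_uIoc] with s hs
  exact ((T s).le_opNorm _).trans (by gcongr; exact hC s (uIoc_subset_uIcc hs))

/-- Variation of constants for Carathéodory solutions of `ẋ = L x + (v - L x)`. -/
theorem eq_exp_add_integral [CompleteSpace E] (L : E →L[ℝ] E) {x v : ℝ → E} {a b : ℝ} (hab : a ≤ b)
    (hv : IntervalIntegrable v volume a b)
    (hx : ∀ t ∈ Icc a b, x t = x a + ∫ s in a..t, v s) :
    x b = exp ((b - a) • L) (x a) + ∫ s in a..b, exp ((b - s) • L) (v s - L (x s)) := by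
  have huI : uIcc a b = Icc a b := uIcc_of_le hab
  set X : ℝ → E := fun t => x a + ∫ s in a..t, v s with hXdef
  have hXac : AbsolutelyContinuousOnInterval X a b := by
    refine absolutelyContinuousOnInterval_of_dist_le (absolutelyContinuousOnInterval_integral hv) ?_
    intro s _ t _
    simp [hXdef]
  have hxc : ContinuousOn x (uIcc a b) :=
    hXac.continuousOn.congr fun t ht => hx t (huI ▸ ht)
  have hg : IntervalIntegrable (fun s => v s - L (x s)) volume a b :=
    hv.sub (L.continuous.comp_continuousOn hxc).intervalIntegrable
  have hEc := continuous_exp_sub_smul L b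
  have hEg : IntervalIntegrable (fun s => exp ((b - s) • L) (v s - L (x s))) volume a b := by
    exact intervalIntegrable_clm_apply hEc hg
  have hEac : AbsolutelyContinuousOnInterval (fun s : ℝ => exp ((b - s) • L)) a b := by
    refine ContDiffOn.absolutelyContinuousOnInterval (ContDiff.contDiffOn ?_)
    rw [contDiff_one_iff_deriv]
    refine ⟨fun t => (hasDerivAt_exp_sub_smul L b t).differentiableAt, ?_⟩
    simp_rw [funext fun t => (hasDerivAt_exp_sub_smul L b t).deriv]
    fun_prop
  -- The transported state minus the accumulated forcing is absolutely continuous with zero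
  -- derivative a.e., hence constant; the formula compares its values at `a` and `b`.
  have hGac := (absolutelyContinuousOnInterval_clm_apply hEac hXac).sub
    (absolutelyContinuousOnInterval_integral hEg)
  obtain ⟨C, hC⟩ := hGac.const_of_ae_hasDerivAt_zero (by
    filter_upwards [hv.ae_hasDerivAt_integral, hEg.ae_hasDerivAt_integral] with t h1 h2 ht
    have h3 := (hasDerivAt_exp_sub_smul L b t).clm_apply ((h1 ht a (by simp)).const_add (x a))
    have h4 := h3.sub (h2 ht a (by simp))
    convert h4 using 1
    have : x t = x a + ∫ s in a..t, v s := hx t (huI ▸ ht)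
    simp [← this]
    abel)
  have ha := hC a (by simp)
  have hb := hC b (by simp)
  rw [← ha] at hb
  simp only [Pi.sub_apply, sub_self, zero_smul, exp_zero, intervalIntegral.integral_same, sub_zero,
    one_apply_eq_self, hXdef, add_zero] at hb
  rw [hx b ⟨hab, le_rfl⟩, ← hb]
  abel

end VariationOfConstants

end DelayPredictor

namespace DelayPredictor

/-! ### The delayed time `φ` and its inverse. -/

section Delay

variable {D : ℝ → ℝ}

theorem RegularDelay.phi_lt (hreg : RegularDelay D) (t : ℝ) : phi D t < t := by
  have := hreg.pos t
  simp only [phi]; linarith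

theorem RegularDelay.hasDerivAt (hreg : RegularDelay D) {t : ℝ} (ht : 0 < t) :
    HasDerivAt (phi D) (deriv (phi D) t) t :=
  ((hreg.contDiffOn.differentiableOn (by simp)).differentiableAt (Ioi_mem_nhds ht)).hasDerivAt

theorem RegularDelay.continuousOn_deriv (hreg : RegularDelay D) :
    ContinuousOn (deriv (phi D)) (Ioi 0) :=
  hreg.contDiffOn.continuousOn_deriv_of_isOpen isOpen_Ioi le_rfl

/-- Mean value inequality. This linear growth makes `φ` invertible and converts decay in `φ(t)` into
decay in `t`. -/
theorem RegularDelay.exists_mul_sub_le (hreg : RegularDelay D) (hinv : DelayInvertible D) :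
    ∃ κ > 0, ∀ s ≥ 0, ∀ t ≥ s, κ * (t - s) ≤ phi D t - phi D s := by
  obtain ⟨κ, hκ, h⟩ := hinv.lower
  refine ⟨κ, hκ, fun s hs t hst => ?_⟩
  refine (convex_Ici (0 : ℝ)).mul_sub_le_image_sub_of_le_deriv hreg.continuousOn ?_ ?_ s hs t
    (le_trans hs hst) hst
  · rw [interior_Ici]
    exact hreg.contDiffOn.differentiableOn (by simp)
  · rw [interior_Ici]
    exact fun x hx => h x hx

theorem RegularDelay.strictMonoOn (hreg : RegularDelay D) (hinv : DelayInvertible D) :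
    StrictMonoOn (phi D) (Ici 0) := by
  obtain ⟨κ, hκ, h⟩ := hreg.exists_mul_sub_le hinv
  intro s hs t _ hst
  have := h s hs t hst.le
  have : 0 < κ * (t - s) := mul_pos hκ (by linarith)
  linarith

theorem RegularDelay.surjOn (hreg : RegularDelay D) (hinv : DelayInvertible D) :
    SurjOn (phi D) (Ici 0) (Ici (phi D 0)) := by
  obtain ⟨κ, hκ, h⟩ := hreg.exists_mul_sub_le hinv
  intro y hy
  have hy' : 0 ≤ (y - phi D 0) / κ := div_nonneg (sub_nonneg.2 hy) hκ.le
  have h1 := h 0 le_rfl _ hy'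
  rw [sub_zero, mul_div_cancel₀ _ hκ.ne'] at h1
  obtain ⟨t, ht, rfl⟩ := intermediate_value_Icc hy'
    (hreg.continuousOn.mono Icc_subset_Ici_self) ⟨hy, by linarith⟩
  exact ⟨t, ht.1, rfl⟩

theorem RegularDelay.phiInv_nonneg (hreg : RegularDelay D) (hinv : DelayInvertible D) {t : ℝ}
    (ht : 0 ≤ t) : 0 ≤ phiInv D t :=
  Function.invFunOn_mem (hreg.surjOn hinv (le_trans (hreg.phi_lt 0).le ht))

theorem RegularDelay.phi_phiInv (hreg : RegularDelay D) (hinv : DelayInvertible D) {t : ℝ}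
    (ht : 0 ≤ t) : phi D (phiInv D t) = t :=
  Function.invFunOn_eq (hreg.surjOn hinv (le_trans (hreg.phi_lt 0).le ht))

theorem RegularDelay.phiInv_phi (hreg : RegularDelay D) (hinv : DelayInvertible D) {t : ℝ}
    (ht : 0 ≤ t) : phiInv D (phi D t) = t :=
  (hreg.strictMonoOn hinv).injOn.leftInvOn_invFunOn ht

theorem RegularDelay.le_phiInv (hreg : RegularDelay D) (hinv : DelayInvertible D) {t : ℝ}
    (ht : 0 ≤ t) : t ≤ phiInv D t := by
  have := hreg.phi_lt (phiInv D t)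
  rw [hreg.phi_phiInv hinv ht] at this
  exact this.le

/-- The hypothesis bounds the delay only beyond `φ⁻¹(0)`; continuity on a compact interval covers
the rest. -/
theorem RegularDelay.exists_le (hreg : RegularDelay D) (hpos : DelayPositiveBounded D) :
    ∃ R > 0, ∀ t ≥ 0, t - phi D t ≤ R := by
  obtain ⟨R₁, h₁⟩ := hpos.upper
  obtain ⟨R₂, h₂⟩ := (isCompact_Icc (a := 0) (b := phiInv D 0)).exists_bound_of_continuousOn
    (continuousOn_id.sub (hreg.continuousOn.mono Icc_subset_Ici_self))
  refine ⟨max 1 (max R₁ R₂), by positivity, fun t ht => ?_⟩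
  rcases le_total (phiInv D 0) t with h | h
  · exact le_max_of_le_right (le_max_of_le_left (h₁ ⟨t, h, rfl⟩))
  · exact le_max_of_le_right (le_max_of_le_right ((le_abs_self _).trans (h₂ t ⟨ht, h⟩)))

theorem RegularDelay.image_Ioo (hreg : RegularDelay D) (hinv : DelayInvertible D) {t : ℝ}
    (ht : 0 ≤ t) : phi D '' Ioo 0 t = Ioo (phi D 0) (phi D t) := by
  refine Subset.antisymm ?_
    (intermediate_value_Ioo ht (hreg.continuousOn.mono Icc_subset_Ici_self))
  rintro _ ⟨s, hs, rfl⟩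
  exact ⟨hreg.strictMonoOn hinv self_mem_Ici (mem_Ici.2 hs.1.le) hs.1,
    hreg.strictMonoOn hinv (mem_Ici.2 hs.1.le) (mem_Ici.2 ht) hs.2⟩

end Delay

/-! ### Carathéodory solutions. -/

section Solutions

variable {n : ℕ} {t₀ : ℝ} {x y v w : ℝ → EuclideanSpace ℝ (Fin n)}

theorem SolvesFrom.intervalIntegrable (h : SolvesFrom t₀ x v) {a b : ℝ} (ha : t₀ ≤ a)
    (hb : t₀ ≤ b) : IntervalIntegrable v volume a b :=
  (h a ha).1.symm.trans (h b hb).1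

theorem SolvesFrom.eq_add_integral (h : SolvesFrom t₀ x v) {a b : ℝ} (ha : t₀ ≤ a)
    (hb : t₀ ≤ b) : x b = x a + ∫ s in a..b, v s := by
  rw [(h b hb).2, (h a ha).2, add_assoc,
    intervalIntegral.integral_add_adjacent_intervals (h a ha).1 (h.intervalIntegrable ha hb)]

theorem SolvesFrom.sub (hx : SolvesFrom t₀ x v) (hy : SolvesFrom t₀ y w) :
    SolvesFrom t₀ (fun t => x t - y t) (fun t => v t - w t) := by
  intro t ht
  refine ⟨(hx t ht).1.sub (hy t ht).1, ?_⟩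
  simp only
  rw [intervalIntegral.integral_sub (hx t ht).1 (hy t ht).1, (hx t ht).2, (hy t ht).2]
  abel

theorem SolvesFrom.congr (h : SolvesFrom t₀ x v) (hvw : ∀ t ≥ t₀, v t = w t) :
    SolvesFrom t₀ x w := by
  intro t ht
  have heq : EqOn v w (uIcc t₀ t) := by
    rw [uIcc_of_le ht]
    exact fun s hs => hvw s hs.1
  refine ⟨(h t ht).1.congr (heq.mono uIoc_subset_uIcc), ?_⟩
  rw [(h t ht).2, intervalIntegral.integral_congr heq]

theorem SolvesFrom.continuousOn (h : SolvesFrom t₀ x v) : ContinuousOn x (Ici t₀) := by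
  intro t ht
  have hc : ContinuousOn x (Icc t₀ (t + 1)) := by
    have h1 := intervalIntegral.continuousOn_primitive_interval' (b₁ := t₀)
      (h (t + 1) (le_trans ht (by linarith))).1 left_mem_uIcc
    rw [uIcc_of_le (le_trans ht (by linarith))] at h1
    exact (continuousOn_const (c := x t₀)).add h1 |>.congr fun s hs => (h s hs.1).2
  refine (hc t ⟨ht, by linarith⟩).mono_of_mem_nhdsWithin ?_
  rw [← Ici_inter_Iic]
  exact Filter.inter_mem self_mem_nhdsWithin (mem_nhdsWithin_of_mem_nhds (Iic_mem_nhds (by simp)))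

theorem SolvesFrom.hasDerivAt (h : SolvesFrom t₀ x v) (hv : ContinuousOn v (Ioi t₀)) {t : ℝ}
    (ht : t₀ < t) : HasDerivAt x (v t) t := by
  have h1 := intervalIntegral.integral_hasDerivAt_right (h t ht.le).1
    (hv.stronglyMeasurableAtFilter isOpen_Ioi t ht) (hv.continuousAt (Ioi_mem_nhds ht))
  refine (h1.const_add (x t₀)).congr_of_eventuallyEq ?_
  filter_upwards [Ioi_mem_nhds ht] with s hs
  exact (h s (le_of_lt hs)).2

/-- Carathéodory solutions under the change of the time variable `φ`. -/
theorem SolvesFrom.comp_phi {D : ℝ → ℝ} (hreg : RegularDelay D) (hinv : DelayInvertible D)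
    (h : SolvesFrom (phi D 0) x v) :
    SolvesFrom 0 (fun t => x (phi D t)) (fun t => deriv (phi D) t • v (phi D t)) := by
  intro t ht
  have hmono := hreg.strictMonoOn hinv
  have hle : phi D 0 ≤ phi D t := hmono.monotoneOn self_mem_Ici (mem_Ici.2 ht) ht
  obtain ⟨κ, hκ, hlow⟩ := hinv.lower
  -- Open intervals are used because `φ` need not be differentiable at `0`; endpoints are null.
  have hder : ∀ s ∈ Ioo 0 t, HasDerivWithinAt (phi D) (deriv (phi D) s) (Ioo 0 t) s :=
    fun s hs => (hreg.hasDerivAt hs.1).hasDerivWithinAt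
  have hinj : InjOn (phi D) (Ioo 0 t) := hmono.injOn.mono fun s hs => hs.1.le
  have habs : EqOn (fun s => |deriv (phi D) s| • v (phi D s))
      (fun s => deriv (phi D) s • v (phi D s)) (Ioo 0 t) := fun s hs => by
    simp only [abs_of_pos (hκ.trans_le (hlow s hs.1))]
  constructor
  · rw [intervalIntegrable_iff_integrableOn_Ioo_of_le ht, ← integrableOn_congr_fun habs
      measurableSet_Ioo, ← integrableOn_image_iff_integrableOn_abs_deriv_smul measurableSet_Ioo hder
      hinj, hreg.image_Ioo hinv ht, ← intervalIntegrable_iff_integrableOn_Ioo_of_le hle]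
    exact (h _ hle).1
  · simp only
    rw [(h _ hle).2, intervalIntegral.integral_of_le ht, intervalIntegral.integral_of_le hle,
      integral_Ioc_eq_integral_Ioo, integral_Ioc_eq_integral_Ioo, ← hreg.image_Ioo hinv ht,
      integral_image_eq_integral_abs_deriv_smul measurableSet_Ioo hder hinj,
      setIntegral_congr_fun measurableSet_Ioo habs]

/-- A solution of `ẋ = φ' L x` is a matrix exponential in the time variable `φ`. -/
theorem SolvesFrom.eq_exp_phi {D : ℝ → ℝ} (hreg : RegularDelay D)
    (L : EuclideanSpace ℝ (Fin n) →L[ℝ] EuclideanSpace ℝ (Fin n))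
    (h : SolvesFrom 0 x fun t => deriv (phi D) t • L (x t)) {t : ℝ} (ht : 0 ≤ t) :
    x t = NormedSpace.exp ((phi D t - phi D 0) • L) (x 0) := by
  set g : ℝ → EuclideanSpace ℝ (Fin n) :=
    fun s => NormedSpace.exp ((phi D t - phi D s) • L) (x s) with hg
  -- Continuity of `φ'` on `(0, ∞)` makes the derivative of `x` classical there.
  have hder : ∀ s > 0, HasDerivAt g 0 s := by
    intro s hs
    have h1 : HasDerivAt x (deriv (phi D) s • L (x s)) s :=
      h.hasDerivAt (hreg.continuousOn_deriv.smul
        (L.continuous.comp_continuousOn (h.continuousOn.mono Ioi_subset_Ici_self))) hs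
    have h2 := ((hasDerivAt_exp_sub_smul L (phi D t) (phi D s)).scomp s
      (hreg.hasDerivAt hs)).clm_apply h1
    simpa [Function.comp_def] using h2
  have hcont : ContinuousOn g (Ici 0) :=
    ((continuous_exp_sub_smul L (phi D t)).comp_continuousOn hreg.continuousOn).clm_apply
      h.continuousOn
  have hconst : ∀ s > 0, g s = g 1 := fun s hs =>
    isOpen_Ioi.is_const_of_deriv_eq_zero (isPreconnected_Ioi (a := (0 : ℝ)))
      (fun u hu => (hder u hu).differentiableAt.differentiableWithinAt)
      (fun u hu => (hder u hu).deriv) hs (mem_Ioi.2 one_pos)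
  -- Only continuity is available at `0`, so `g 0` is reached as a right limit.
  have h0 : g 0 = g 1 := by
    have h1 : Filter.Tendsto g (nhdsWithin 0 (Ioi 0)) (nhds (g 0)) :=
      (hcont 0 self_mem_Ici).mono Ioi_subset_Ici_self
    refine tendsto_nhds_unique h1 (Filter.Tendsto.congr' ?_ tendsto_const_nhds)
    filter_upwards [self_mem_nhdsWithin] with s hs using (hconst s hs).symm
  have ht' : g t = g 0 := by
    rcases ht.eq_or_lt with rfl | ht
    · rfl
    · rw [hconst t ht, h0]
  have hz : NormedSpace.exp ((0 : ℝ) • L) = 1 := by rw [zero_smul ℝ L, NormedSpace.exp_zero]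
  simpa only [hg, sub_self, hz, one_apply_eq_self] using ht'

/-- Exponentially stable linear dynamics with an exponentially decaying forcing term. -/
theorem SolvesFrom.norm_le_of_forcing_le
    {L : EuclideanSpace ℝ (Fin n) →L[ℝ] EuclideanSpace ℝ (Fin n)} {C c : ℝ} (hC : 0 ≤ C)
    (hL : ∀ t ≥ (0 : ℝ), ‖NormedSpace.exp (t • L)‖ ≤ C * Real.exp (-c * t))
    (h : SolvesFrom t₀ x v) {a b H : ℝ} (ha : t₀ ≤ a) (hab : a ≤ b)
    (hH : ∀ s > a, ‖v s - L (x s)‖ ≤ H * Real.exp (-c * s)) :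
    ‖x b‖ ≤ C * Real.exp (-c * (b - a)) * ‖x a‖ + C * H * Real.exp (-c * b) * (b - a) := by
  rw [eq_exp_add_integral L hab (h.intervalIntegrable ha (ha.trans hab))
    (fun t ht => h.eq_add_integral ha (ha.trans ht.1))]
  refine (norm_add_le _ _).trans (add_le_add ?_ ?_)
  · exact ((NormedSpace.exp ((b - a) • L)).le_opNorm _).trans
      (by gcongr; exact hL _ (by linarith))
  · rw [← abs_of_nonneg (sub_nonneg.2 hab)]
    -- Equal rates make `e^{-c(b-s)} e^{-cs}` independent of `s`, whence the factor `b - a`.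
    refine intervalIntegral.norm_integral_le_of_norm_le_const fun s hs => ?_
    rw [uIoc_of_le hab] at hs
    calc _ ≤ ‖NormedSpace.exp ((b - s) • L)‖ * ‖v s - L (x s)‖ := ContinuousLinearMap.le_opNorm _ _
      _ ≤ (C * Real.exp (-c * (b - s))) * (H * Real.exp (-c * s)) := by
        gcongr
        · exact hL _ (by linarith [hs.2])
        · exact hH s hs.1
      _ = C * H * (Real.exp (-c * (b - s)) * Real.exp (-c * s)) := by ring
      _ = C * H * Real.exp (-c * b) := by rw [← Real.exp_add]; congr 2; ring

end Solutions

end DelayPredictor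

/-! ### Exact error identities for the closed loop. -/

namespace DelayPredictor

namespace ControlSystem

variable {n m p : ℕ} (S : ControlSystem n m p)

theorem flow_eq (r : ℝ) (x : EuclideanSpace ℝ (Fin n)) :
    S.flow r x = NormedSpace.exp (r • Matrix.toEuclideanCLM (𝕜 := ℝ) S.A) x := by
  rw [← map_smul, ← toEuclideanCLM_exp]
  rfl

theorem toEuclideanLin_mul_apply {l : ℕ} (M : Matrix (Fin n) (Fin m) ℝ)
    (N : Matrix (Fin m) (Fin l) ℝ) (x : EuclideanSpace ℝ (Fin l)) :
    Matrix.toEuclideanLin (M * N) x = Matrix.toEuclideanLin M (Matrix.toEuclideanLin N x) := by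
  simp [Matrix.toLpLin_apply, Matrix.mulVec_mulVec]

theorem exists_norm_toEuclideanLin_le (M : Matrix (Fin n) (Fin m) ℝ) :
    ∃ C > 0, ∀ x, ‖Matrix.toEuclideanLin M x‖ ≤ C * ‖x‖ :=
  SemilinearMapClass.bound_of_continuous _
    (Matrix.toEuclideanLin M).continuous_of_finiteDimensional

theorem exists_norm_flow_le (R : ℝ) :
    ∃ C > 0, ∀ r, |r| ≤ R → ∀ x, ‖S.flow r x‖ ≤ C * ‖x‖ := by
  have hc := continuous_exp_smul (Matrix.toEuclideanCLM (𝕜 := ℝ) S.A)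
  obtain ⟨C, hC⟩ := (isCompact_Icc (a := -R) (b := R)).exists_bound_of_continuousOn hc.continuousOn
  refine ⟨|C| + 1, by positivity, fun r hr x => ?_⟩
  rw [flow_eq]
  refine (ContinuousLinearMap.le_opNorm _ x).trans ?_
  gcongr
  exact (hC r (abs_le.1 hr)).trans (by linarith [le_abs_self C])

theorem flow_neg_flow (r : ℝ) (x : EuclideanSpace ℝ (Fin n)) : S.flow (-r) (S.flow r x) = x := by
  rw [flow_eq, flow_eq, exp_neg_smul_apply_exp_smul]

theorem flow_sub (r : ℝ) (x y : EuclideanSpace ℝ (Fin n)) :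
    S.flow r (x - y) = S.flow r x - S.flow r y := by
  simp [flow]

variable {S} {Z : ℝ → EuclideanSpace ℝ (Fin n)} {Y : ℝ → EuclideanSpace ℝ (Fin p)}
  {U : ℝ → EuclideanSpace ℝ (Fin m)} {ξ : ℝ → EuclideanSpace ℝ (Fin n)}

theorem IsClosedLoopSolution.eq_flow_add_integral (h : S.IsClosedLoopSolution Z Y U ξ) {a b : ℝ}
    (ha : S.φ₂ 0 ≤ a) (hab : a ≤ b) :
    Z b = S.flow (b - a) (Z a) +
      ∫ s in a..b, S.flow (b - s) (Matrix.toEuclideanLin S.B (U (S.φ₁ s))) := by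
  rw [eq_exp_add_integral (Matrix.toEuclideanCLM (𝕜 := ℝ) S.A) hab
    (h.plant.intervalIntegrable ha (ha.trans hab))
    (fun t ht => h.plant.eq_add_integral ha (ha.trans ht.1)), flow_eq]
  congr 1
  refine intervalIntegral.integral_congr fun s _ => ?_
  simp only [flow_eq]
  congr 1
  exact add_sub_cancel_left _ _

/-- The observer error, in the time scale `φ₂`, is governed by `A - L C`. -/
theorem IsClosedLoopSolution.observer_error (h : S.IsClosedLoopSolution Z Y U ξ)
    (hreg₂ : RegularDelay S.D₂) (hinv₂ : DelayInvertible S.D₂) {t : ℝ} (ht : 0 ≤ t) :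
    Z (S.φ₂ t) - ξ t = NormedSpace.exp ((S.φ₂ t - S.φ₂ 0) •
      Matrix.toEuclideanCLM (𝕜 := ℝ) (S.A - S.L * S.C)) (Z (S.φ₂ 0) - ξ 0) := by
  -- In the time `φ₂` the plant has the observer's input, so it cancels in the difference.
  have hX := h.plant.comp_phi hreg₂ hinv₂
  refine ((hX.sub h.observer).congr fun s hs => ?_).eq_exp_phi hreg₂ _ ht
  have hL : Matrix.toEuclideanCLM (𝕜 := ℝ) (S.A - S.L * S.C) (Z (phi S.D₂ s) - ξ s) =
      Matrix.toEuclideanLin S.A (Z (phi S.D₂ s) - ξ s) -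
        Matrix.toEuclideanLin S.L (Matrix.toEuclideanLin S.C (Z (phi S.D₂ s) - ξ s)) := by
    rw [← toEuclideanLin_mul_apply, ← LinearMap.sub_apply, ← map_sub]
    rfl
  rw [h.output s hs, hL]
  change deriv (phi S.D₂) s • (Matrix.toEuclideanLin S.A (Z (phi S.D₂ s)) +
    Matrix.toEuclideanLin S.B (U (S.φ₁ (S.φ₂ s)))) - deriv (phi S.D₂) s •
    (Matrix.toEuclideanLin S.A (ξ s) + Matrix.toEuclideanLin S.B (U (S.φ₁ (S.φ₂ s))) +
      Matrix.toEuclideanLin S.L (Matrix.toEuclideanLin S.C (Z (phi S.D₂ s)) -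
        Matrix.toEuclideanLin S.C (ξ s))) = _
  rw [← smul_sub]
  simp only [map_sub]
  congr 1
  abel

/-- `Ẑ(t)` is the plant formula on `[φ₂(t), t]` started from `ξ(t)` instead of `Z(φ₂ t)`; the input
integrals cancel. -/
theorem IsClosedLoopSolution.sub_Zhat (h : S.IsClosedLoopSolution Z Y U ξ)
    (hreg₂ : RegularDelay S.D₂) (hinv₂ : DelayInvertible S.D₂) {t : ℝ} (ht : 0 ≤ t) :
    Z t - S.Zhat U ξ t = S.flow (t - S.φ₂ t) (Z (S.φ₂ t) - ξ t) := by
  have hle : S.φ₂ 0 ≤ S.φ₂ t :=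
    (hreg₂.strictMonoOn hinv₂).monotoneOn self_mem_Ici (mem_Ici.2 ht) ht
  rw [h.eq_flow_add_integral hle (hreg₂.phi_lt t).le, Zhat, flow_sub]
  abel

/-- The estimation error decays exponentially. -/
theorem exists_norm_sub_Zhat_le (hreg₂ : RegularDelay S.D₂) (hpos₂ : DelayPositiveBounded S.D₂)
    (hinv₂ : DelayInvertible S.D₂) (hL : IsHurwitz (S.A - S.L * S.C)) :
    ∃ M > 0, ∃ c > 0, ∀ Z Y U ξ, S.IsClosedLoopSolution Z Y U ξ → ∀ t ≥ 0,
      ‖Z t - S.Zhat U ξ t‖ ≤ M * Real.exp (-c * t) * ‖Z 0 - S.Zhat U ξ 0‖ := by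
  obtain ⟨C, hC, c, hc, hdecay⟩ := hL.exists_norm_exp_le
  obtain ⟨κ, hκ, hgrowth⟩ := hreg₂.exists_mul_sub_le hinv₂
  obtain ⟨R, hR, hdelay⟩ := hreg₂.exists_le hpos₂
  obtain ⟨F, hF, hflow⟩ := S.exists_norm_flow_le R
  -- One `F` flows the error forward to time `t`; the other flows it backward at time `0`, to
  -- express the observer error through `Z 0 - Ẑ 0`.
  refine ⟨F * C * F, by positivity, c * κ, by positivity, fun Z Y U ξ h t ht => ?_⟩
  have habs : ∀ s ≥ 0, |s - S.φ₂ s| ≤ R := fun s hs => by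
    have : 0 ≤ s - S.φ₂ s := sub_nonneg.2 (hreg₂.phi_lt s).le
    rw [abs_of_nonneg this]
    exact hdelay s hs
  have h0 : ‖Z (S.φ₂ 0) - ξ 0‖ ≤ F * ‖Z 0 - S.Zhat U ξ 0‖ := by
    rw [← S.flow_neg_flow (0 - S.φ₂ 0) (Z (S.φ₂ 0) - ξ 0), ← h.sub_Zhat hreg₂ hinv₂ le_rfl]
    exact hflow _ (by rw [abs_neg]; exact habs 0 le_rfl) _
  have hg : κ * t ≤ S.φ₂ t - S.φ₂ 0 := by
    have := hgrowth 0 le_rfl t ht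
    rwa [sub_zero] at this
  have h1 : ‖Z (S.φ₂ t) - ξ t‖ ≤ C * Real.exp (-(c * κ) * t) * ‖Z (S.φ₂ 0) - ξ 0‖ := by
    rw [h.observer_error hreg₂ hinv₂ ht]
    refine (ContinuousLinearMap.le_opNorm _ _).trans ?_
    gcongr
    refine (hdecay _ (le_trans (by positivity) hg)).trans ?_
    refine mul_le_mul_of_nonneg_left (Real.exp_le_exp.2 ?_) hC.le
    nlinarith
  rw [h.sub_Zhat hreg₂ hinv₂ ht]
  calc _ ≤ F * ‖Z (S.φ₂ t) - ξ t‖ := hflow _ (habs t ht) _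
    _ ≤ F * (C * Real.exp (-(c * κ) * t) * (F * ‖Z 0 - S.Zhat U ξ 0‖)) := by
      gcongr
      exact h1.trans (by gcongr)
    _ = _ := by ring

/-- The predictor runs the plant from `t` to `φ₁⁻¹(t)` with the true input, so its only error is
that of `Ẑ`. -/
theorem IsClosedLoopSolution.control_eq (h : S.IsClosedLoopSolution Z Y U ξ)
    (hreg₁ : RegularDelay S.D₁) (hreg₂ : RegularDelay S.D₂) (hinv₁ : DelayInvertible S.D₁)
    {t : ℝ} (ht : 0 < t) :
    U t = Matrix.toEuclideanLin S.K
      (Z (phiInv S.D₁ t) - S.flow (S.ψ t) (Z t - S.Zhat U ξ t)) := by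
  have hψ : t + S.ψ t = phiInv S.D₁ t := by simp [ψ, horizon]
  rw [h.control t ht, Phat, hψ, h.eq_flow_add_integral (a := t) (b := phiInv S.D₁ t)
    ((hreg₂.phi_lt 0).le.trans ht.le) (hreg₁.le_phiInv hinv₁ ht.le), flow_sub]
  congr 1
  change _ = S.flow (S.ψ t) (Z t) + _ - _
  abel

/-- The horizon at `t` is the delay at `φ⁻¹(t)`. -/
theorem abs_horizon_le {D : ℝ → ℝ} (hreg : RegularDelay D) (hinv : DelayInvertible D) {R : ℝ}
    (hR : ∀ t ≥ 0, t - phi D t ≤ R) {t : ℝ} (ht : 0 ≤ t) : |horizon D t| ≤ R := by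
  have h1 := hR _ (hreg.phiInv_nonneg hinv ht)
  rw [hreg.phi_phiInv hinv ht] at h1
  rw [horizon, abs_of_nonneg (sub_nonneg.2 (hreg.le_phiInv hinv ht))]
  exact h1

/-- Until the first control action reaches the plant, the state is bounded by the data. -/
theorem exists_norm_le_of_le_phiInv (hreg₁ : RegularDelay S.D₁) (hreg₂ : RegularDelay S.D₂)
    (hinv₁ : DelayInvertible S.D₁) :
    ∃ M > 0, ∀ Z Y U ξ, S.IsClosedLoopSolution Z Y U ξ → ∀ G, ‖Z 0‖ ≤ G →
      (∀ τ ∈ Icc (S.φ₁ 0) 0, ‖U τ‖ ≤ G) → ∀ t ∈ Icc 0 (phiInv S.D₁ 0), ‖Z t‖ ≤ M * G := by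
  obtain ⟨F, hF, hflow⟩ := S.exists_norm_flow_le (phiInv S.D₁ 0)
  obtain ⟨b, hb, hB⟩ := exists_norm_toEuclideanLin_le S.B
  have hσ := hreg₁.phiInv_nonneg hinv₁ le_rfl
  refine ⟨F + F * b * phiInv S.D₁ 0, by positivity, fun Z Y U ξ h G hZ hU t ht => ?_⟩
  have hG : 0 ≤ G := (norm_nonneg _).trans hZ
  have hmono := (hreg₁.strictMonoOn hinv₁).monotoneOn
  rw [h.eq_flow_add_integral (hreg₂.phi_lt 0).le ht.1, add_mul]
  refine (norm_add_le _ _).trans (add_le_add ?_ ?_)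
  · refine (hflow _ ?_ _).trans (by gcongr)
    rw [sub_zero, abs_of_nonneg ht.1]
    exact ht.2
  · refine (intervalIntegral.norm_integral_le_of_norm_le_const (C := F * (b * G))
      fun s hs => ?_).trans ?_
    · rw [uIoc_of_le ht.1] at hs
      refine (hflow _ ?_ _).trans ?_
      · rw [abs_of_nonneg (by linarith [hs.2])]
        linarith [hs.1, ht.2]
      · gcongr
        refine (hB _).trans ?_
        gcongr
        -- Here `φ₁(s)` lies in `[φ₁(0), 0]`, where the input is initial data.
        refine hU _ ⟨hmono self_mem_Ici (mem_Ici.2 hs.1.le) hs.1.le, ?_⟩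
        rw [← hreg₁.phi_phiInv hinv₁ le_rfl]
        exact hmono (mem_Ici.2 hs.1.le) (mem_Ici.2 hσ) (hs.2.trans ht.2)
    · rw [sub_zero, abs_of_nonneg ht.1]
      calc F * (b * G) * t ≤ F * (b * G) * phiInv S.D₁ 0 := by gcongr; exact ht.2
        _ = _ := by ring

/-- After the first control action has reached the plant, the plant is the nominal closed loop
`A + B K` perturbed by the estimation error. -/
theorem IsClosedLoopSolution.plant_sub_nominal (h : S.IsClosedLoopSolution Z Y U ξ)
    (hreg₁ : RegularDelay S.D₁) (hreg₂ : RegularDelay S.D₂) (hinv₁ : DelayInvertible S.D₁)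
    {s : ℝ} (hs : phiInv S.D₁ 0 < s) :
    Matrix.toEuclideanLin S.A (Z s) + Matrix.toEuclideanLin S.B (U (s - S.D₁ s)) -
        Matrix.toEuclideanCLM (𝕜 := ℝ) (S.A + S.B * S.K) (Z s) =
      -Matrix.toEuclideanLin S.B (Matrix.toEuclideanLin S.K
        (S.flow (S.ψ (S.φ₁ s)) (Z (S.φ₁ s) - S.Zhat U ξ (S.φ₁ s)))) := by
  have hσ := hreg₁.phiInv_nonneg hinv₁ le_rfl
  have hs0 : 0 ≤ s := hσ.trans hs.le
  -- Strict positivity is needed: the control law is imposed only at positive times.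
  have hpos : 0 < S.φ₁ s := by
    rw [← hreg₁.phi_phiInv hinv₁ le_rfl]
    exact hreg₁.strictMonoOn hinv₁ (mem_Ici.2 hσ) (mem_Ici.2 hs0) hs
  have hU : U (s - S.D₁ s) = U (S.φ₁ s) := rfl
  have hN : Matrix.toEuclideanCLM (𝕜 := ℝ) (S.A + S.B * S.K) (Z s) =
      Matrix.toEuclideanLin S.A (Z s) +
        Matrix.toEuclideanLin S.B (Matrix.toEuclideanLin S.K (Z s)) := by
    rw [← toEuclideanLin_mul_apply, ← LinearMap.add_apply, ← map_add]
    rfl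
  have hinv : phiInv S.D₁ (S.φ₁ s) = s := hreg₁.phiInv_phi hinv₁ hs0
  rw [hU, hN, h.control_eq hreg₁ hreg₂ hinv₁ hpos, hinv]
  simp only [map_sub]
  abel

end ControlSystem

end DelayPredictor

/-! ### Decay of the state and of the input. -/

namespace DelayPredictor

namespace ControlSystem

variable {n m p : ℕ} {S : ControlSystem n m p}

/-- The plant state decays exponentially. -/
theorem exists_norm_plant_le (hreg₁ : RegularDelay S.D₁) (hreg₂ : RegularDelay S.D₂)
    (hpos₁ : DelayPositiveBounded S.D₁) (hpos₂ : DelayPositiveBounded S.D₂)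
    (hinv₁ : DelayInvertible S.D₁) (hinv₂ : DelayInvertible S.D₂)
    (hK : IsHurwitz (S.A + S.B * S.K)) (hL : IsHurwitz (S.A - S.L * S.C)) :
    ∃ M > 0, ∃ c > 0, ∀ Z Y U ξ, S.IsClosedLoopSolution Z Y U ξ → ∀ G, ‖Z 0‖ ≤ G →
      ‖Z 0 - S.Zhat U ξ 0‖ ≤ G → (∀ τ ∈ Icc (S.φ₁ 0) 0, ‖U τ‖ ≤ G) →
      ∀ t ≥ 0, ‖Z t‖ ≤ M * Real.exp (-c * t) * G := by
  obtain ⟨M₁, hM₁, c₁, hc₁, herr⟩ := exists_norm_sub_Zhat_le hreg₂ hpos₂ hinv₂ hL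
  obtain ⟨M₂, hM₂, c₂, hc₂, hnom⟩ := hK.exists_norm_exp_le
  obtain ⟨M₀, hM₀, hinit⟩ := exists_norm_le_of_le_phiInv hreg₁ hreg₂ hinv₁
  obtain ⟨R, hR, hdelay⟩ := hreg₁.exists_le hpos₁
  obtain ⟨F, hF, hflow⟩ := S.exists_norm_flow_le R
  obtain ⟨b, hb, hB⟩ := exists_norm_toEuclideanLin_le S.B
  obtain ⟨k, hk, hKle⟩ := exists_norm_toEuclideanLin_le S.K
  set σ := phiInv S.D₁ 0 with hσdef
  have hσ : 0 ≤ σ := hreg₁.phiInv_nonneg hinv₁ le_rfl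
  set c := min c₁ c₂ with hcdef
  have hc : 0 < c := lt_min hc₁ hc₂
  -- The forcing is `BK` applied to a flow of the error at time `φ₁(s) ≥ s - R`; the lag costs
  -- `e^{cR}`.
  set H := b * (k * (F * (M₁ * Real.exp (c * R)))) with hHdef
  have hH : 0 < H := by positivity
  -- The summands pay for the state at `σ`, the forcing after `σ`, and times before `σ`. Halving the
  -- rate absorbs the factor `t - σ`.
  refine ⟨M₂ * Real.exp (c * σ) * M₀ + M₂ * H * (2 / c) + M₀ * Real.exp (c * σ), by positivity,
    c / 2, by positivity, fun Z Y U ξ h G hZ hw hU t ht => ?_⟩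
  have hG : 0 ≤ G := (norm_nonneg _).trans hZ
  have hexp : Real.exp (-c * t) ≤ Real.exp (-(c / 2) * t) := by
    rw [Real.exp_le_exp]; nlinarith
  rcases le_total t σ with hts | hts
  · have h1 : (1 : ℝ) ≤ Real.exp (c * σ) * Real.exp (-(c / 2) * t) := by
      rw [← Real.exp_add, Real.one_le_exp_iff]
      nlinarith
    calc ‖Z t‖ ≤ M₀ * G := hinit Z Y U ξ h G hZ hU t ⟨ht, hts⟩
      _ ≤ M₀ * G * (Real.exp (c * σ) * Real.exp (-(c / 2) * t)) :=
        le_mul_of_one_le_right (by positivity) h1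
      _ = M₀ * Real.exp (c * σ) * Real.exp (-(c / 2) * t) * G := by ring
      _ ≤ _ := by
        gcongr
        have : 0 ≤ M₂ * Real.exp (c * σ) * M₀ + M₂ * H * (2 / c) := by positivity
        linarith
  · have hnom' : ∀ r ≥ (0 : ℝ), ‖NormedSpace.exp (r • Matrix.toEuclideanCLM (𝕜 := ℝ)
        (S.A + S.B * S.K))‖ ≤ M₂ * Real.exp (-c * r) := fun r hr =>
      (hnom r hr).trans (by gcongr; exact min_le_right _ _)
    have hforce : ∀ s > σ, ‖(Matrix.toEuclideanLin S.A (Z s) +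
        Matrix.toEuclideanLin S.B (U (s - S.D₁ s))) -
        Matrix.toEuclideanCLM (𝕜 := ℝ) (S.A + S.B * S.K) (Z s)‖ ≤
        H * G * Real.exp (-c * s) := by
      intro s hs
      have hs0 : 0 ≤ s := hσ.trans hs.le
      have hφ : 0 ≤ S.φ₁ s := by
        rw [← hreg₁.phi_phiInv hinv₁ le_rfl]
        exact (hreg₁.strictMonoOn hinv₁).monotoneOn (mem_Ici.2 hσ) (mem_Ici.2 hs0) hs.le
      have hφs : s - R ≤ S.φ₁ s := by
        have : s - S.φ₁ s ≤ R := hdelay s hs0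
        linarith
      have hexps : Real.exp (-c₁ * S.φ₁ s) ≤ Real.exp (c * R) * Real.exp (-c * s) := by
        rw [← Real.exp_add, Real.exp_le_exp]
        have : c * S.φ₁ s ≤ c₁ * S.φ₁ s := by gcongr; exact min_le_left _ _
        nlinarith
      rw [h.plant_sub_nominal hreg₁ hreg₂ hinv₁ hs, norm_neg]
      calc _ ≤ b * (k * (F * (M₁ * (Real.exp (c * R) * Real.exp (-c * s)) * G))) := by
            refine (hB _).trans ?_
            gcongr
            refine (hKle _).trans ?_
            gcongr
            refine (hflow _ (abs_horizon_le hreg₁ hinv₁ hdelay hφ) _).trans ?_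
            gcongr
            refine (herr Z Y U ξ h _ hφ).trans ?_
            gcongr
        _ = _ := by rw [hHdef]; ring
    have hmain := h.plant.norm_le_of_forcing_le hM₂.le hnom'
      ((hreg₂.phi_lt 0).le.trans hσ) hts hforce
    have hZσ := hinit Z Y U ξ h G hZ hU σ ⟨hσ, le_rfl⟩
    have hlin : Real.exp (-c * t) * (t - σ) ≤ 2 / c * Real.exp (-(c / 2) * t) := by
      have h1 : c / 2 * t ≤ Real.exp (c / 2 * t) := by
        linarith [Real.add_one_le_exp (c / 2 * t)]
      have h2 : Real.exp (-c * t) = Real.exp (-(c / 2) * t) * (Real.exp (c / 2 * t))⁻¹ := by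
        rw [← Real.exp_neg, ← Real.exp_add]
        congr 1; ring
      have h3 : (Real.exp (c / 2 * t))⁻¹ * (t - σ) ≤ 2 / c := by
        rw [inv_mul_le_iff₀ (Real.exp_pos _), ← div_le_iff₀ (by positivity)]
        refine le_trans (le_of_eq (by field_simp)) ((mul_le_mul_of_nonneg_left
          (sub_le_self t hσ) (by positivity : 0 ≤ c / 2)).trans h1)
      calc _ = Real.exp (-(c / 2) * t) * ((Real.exp (c / 2 * t))⁻¹ * (t - σ)) := by rw [h2]; ring
        _ ≤ Real.exp (-(c / 2) * t) * (2 / c) := by gcongr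
        _ = _ := by ring
    have hsplit : Real.exp (-c * (t - σ)) = Real.exp (c * σ) * Real.exp (-c * t) := by
      rw [← Real.exp_add]; congr 1; ring
    calc ‖Z t‖ ≤ M₂ * Real.exp (-c * (t - σ)) * ‖Z σ‖ +
          M₂ * (H * G) * Real.exp (-c * t) * (t - σ) := hmain
      _ = M₂ * (Real.exp (c * σ) * Real.exp (-c * t)) * ‖Z σ‖ +
          M₂ * (H * G) * (Real.exp (-c * t) * (t - σ)) := by rw [hsplit]; ring
      _ ≤ M₂ * (Real.exp (c * σ) * Real.exp (-(c / 2) * t)) * (M₀ * G) +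
          M₂ * (H * G) * (2 / c * Real.exp (-(c / 2) * t)) := by gcongr
      _ = (M₂ * Real.exp (c * σ) * M₀ + M₂ * H * (2 / c)) * Real.exp (-(c / 2) * t) * G := by ring
      _ ≤ _ := by
        gcongr ?_ * _ * _
        have : 0 ≤ M₀ * Real.exp (c * σ) := by positivity
        linarith

/-- The input on the delay window decays exponentially. -/
theorem exists_norm_input_le (hreg₁ : RegularDelay S.D₁) (hreg₂ : RegularDelay S.D₂)
    (hpos₁ : DelayPositiveBounded S.D₁) (hinv₁ : DelayInvertible S.D₁)
    {Mz Mw c : ℝ} (hMz : 0 ≤ Mz) (hMw : 0 ≤ Mw) (hc : 0 < c) :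
    ∃ M > 0, ∀ Z Y U ξ, S.IsClosedLoopSolution Z Y U ξ → ∀ G ≥ 0,
      (∀ t ≥ 0, ‖Z t‖ ≤ Mz * Real.exp (-c * t) * G) →
      (∀ t ≥ 0, ‖Z t - S.Zhat U ξ t‖ ≤ Mw * Real.exp (-c * t) * G) →
      (∀ τ ∈ Icc (S.φ₁ 0) 0, ‖U τ‖ ≤ G) →
      ∀ t ≥ 0, ∀ τ ∈ Icc (S.φ₁ t) t, ‖U τ‖ ≤ M * Real.exp (-c * t) * G := by
  obtain ⟨R, hR, hdelay⟩ := hreg₁.exists_le hpos₁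
  obtain ⟨F, hF, hflow⟩ := S.exists_norm_flow_le R
  obtain ⟨k, hk, hKle⟩ := exists_norm_toEuclideanLin_le S.K
  set σ := phiInv S.D₁ 0 with hσdef
  have hσ : 0 ≤ σ := hreg₁.phiInv_nonneg hinv₁ le_rfl
  refine ⟨k * (Mz + F * Mw) * Real.exp (c * R) + Real.exp (c * σ), by positivity,
    fun Z Y U ξ h G hG hZ hw hU t ht τ hτ => ?_⟩
  -- A window that still meets the history forces `t ≤ σ`, so `e^{cσ}` suffices; for `τ > 0` the
  -- feedback formula applies.
  rcases le_or_gt τ 0 with hτ0 | hτ0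
  · have hts : t ≤ σ := by
      rw [← (hreg₁.strictMonoOn hinv₁).le_iff_le (mem_Ici.2 ht) (mem_Ici.2 hσ),
        hreg₁.phi_phiInv hinv₁ le_rfl]
      exact hτ.1.trans hτ0
    have h1 : (1 : ℝ) ≤ Real.exp (c * σ) * Real.exp (-c * t) := by
      rw [← Real.exp_add, Real.one_le_exp_iff]
      nlinarith
    have h2 : S.φ₁ 0 ≤ S.φ₁ t :=
      (hreg₁.strictMonoOn hinv₁).monotoneOn self_mem_Ici (mem_Ici.2 ht) ht
    calc ‖U τ‖ ≤ G := hU τ ⟨h2.trans hτ.1, hτ0⟩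
      _ ≤ Real.exp (c * σ) * Real.exp (-c * t) * G := le_mul_of_one_le_left hG h1
      _ ≤ _ := by
        gcongr
        have : 0 ≤ k * (Mz + F * Mw) * Real.exp (c * R) := by positivity
        linarith
  · have hτR : t - R ≤ τ := by
      have : t - S.φ₁ t ≤ R := hdelay t ht
      linarith [hτ.1]
    have h1 : Real.exp (-c * τ) ≤ Real.exp (c * R) * Real.exp (-c * t) := by
      rw [← Real.exp_add, Real.exp_le_exp]
      nlinarith
    have h2 : Real.exp (-c * phiInv S.D₁ τ) ≤ Real.exp (-c * τ) := by
      rw [Real.exp_le_exp]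
      nlinarith [hreg₁.le_phiInv hinv₁ hτ0.le]
    have h3 : ‖Z (phiInv S.D₁ τ)‖ ≤ Mz * Real.exp (-c * τ) * G :=
      (hZ _ (hreg₁.phiInv_nonneg hinv₁ hτ0.le)).trans (by gcongr)
    have h4 : ‖S.flow (S.ψ τ) (Z τ - S.Zhat U ξ τ)‖ ≤ F * (Mw * Real.exp (-c * τ) * G) :=
      (hflow _ (abs_horizon_le hreg₁ hinv₁ hdelay hτ0.le) _).trans
        (by gcongr; exact hw τ hτ0.le)
    rw [h.control_eq hreg₁ hreg₂ hinv₁ hτ0]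
    calc _ ≤ k * (Mz * Real.exp (-c * τ) * G + F * (Mw * Real.exp (-c * τ) * G)) := by
          refine (hKle _).trans ?_
          gcongr
          exact (norm_sub_le _ _).trans (add_le_add h3 h4)
      _ = k * (Mz + F * Mw) * Real.exp (-c * τ) * G := by ring
      _ ≤ k * (Mz + F * Mw) * (Real.exp (c * R) * Real.exp (-c * t)) * G := by gcongr
      _ = k * (Mz + F * Mw) * Real.exp (c * R) * Real.exp (-c * t) * G := by ring
      _ ≤ _ := by
        gcongr
        have : 0 ≤ Real.exp (c * σ) := by positivity
        linarith

end ControlSystem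

theorem enorm_sq_le_ofReal_sq {E : Type*} [SeminormedAddCommGroup E] {x : E} {a : ℝ}
    (h : ‖x‖ ≤ a) : ‖x‖ₑ ^ 2 ≤ ENNReal.ofReal (a ^ 2) := by
  rw [← ofReal_norm, ← ENNReal.ofReal_pow (norm_nonneg x)]
  exact ENNReal.ofReal_le_ofReal (by gcongr)

theorem norm_le_sqrt_toReal {E : Type*} [SeminormedAddCommGroup E] {x : E} {g : ℝ≥0∞}
    (hg : g ≠ ⊤) (h : ‖x‖ₑ ^ 2 ≤ g) : ‖x‖ ≤ √g.toReal := by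
  refine Real.le_sqrt_of_sq_le ?_
  have := ENNReal.toReal_mono hg h
  simpa using this

end DelayPredictor

/-! ### Assembly of the estimate for `Γ`. -/

theorem theorem1 {n m p : ℕ} (S : DelayPredictor.ControlSystem n m p)
    (hreg₁ : DelayPredictor.RegularDelay S.D₁) (hreg₂ : DelayPredictor.RegularDelay S.D₂)
    (hpos₁ : DelayPredictor.DelayPositiveBounded S.D₁)
    (hpos₂ : DelayPredictor.DelayPositiveBounded S.D₂)
    (hinv₁ : DelayPredictor.DelayInvertible S.D₁)
    (hinv₂ : DelayPredictor.DelayInvertible S.D₂)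
    (hK : DelayPredictor.IsHurwitz (S.A + S.B * S.K))
    (hL : DelayPredictor.IsHurwitz (S.A - S.L * S.C)) :
    ∃ M > (0 : ℝ), ∃ C > (0 : ℝ),
      ∀ (Z : ℝ → EuclideanSpace ℝ (Fin n)) (Y : ℝ → EuclideanSpace ℝ (Fin p))
        (U : ℝ → EuclideanSpace ℝ (Fin m)) (ξ : ℝ → EuclideanSpace ℝ (Fin n)),
        S.IsClosedLoopSolution Z Y U ξ →
          ∀ t ≥ (0 : ℝ),
            S.Gam Z U ξ t ≤ ENNReal.ofReal (M * Real.exp (-C * t)) * S.Gam Z U ξ 0 := by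
  obtain ⟨Mz, hMz, cz, hcz, hplant⟩ := DelayPredictor.ControlSystem.exists_norm_plant_le
    hreg₁ hreg₂ hpos₁ hpos₂ hinv₁ hinv₂ hK hL
  obtain ⟨Mw, hMw, cw, hcw, herr⟩ :=
    DelayPredictor.ControlSystem.exists_norm_sub_Zhat_le hreg₂ hpos₂ hinv₂ hL
  set c := min cz cw with hcdef
  have hc : 0 < c := lt_min hcz hcw
  obtain ⟨Mu, hMu, hinput⟩ := DelayPredictor.ControlSystem.exists_norm_input_le
    hreg₁ hreg₂ hpos₁ hinv₁ hMz.le hMw.le hc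
  refine ⟨Mz ^ 2 + Mw ^ 2 + Mu ^ 2, by positivity, 2 * c, by positivity,
    fun Z Y U ξ h t ht => ?_⟩
  -- The input history may be unbounded, making `Γ(0)` infinite; the bound is then trivial.
  by_cases htop : S.Gam Z U ξ 0 = ⊤
  · rw [htop, ENNReal.mul_top (by
      rw [Ne, ENNReal.ofReal_eq_zero, not_le]; positivity)]
    exact le_top
  set G := √(S.Gam Z U ξ 0).toReal with hGdef
  have hG : 0 ≤ G := Real.sqrt_nonneg _
  have hGsq : S.Gam Z U ξ 0 = ENNReal.ofReal (G ^ 2) := by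
    rw [hGdef, Real.sq_sqrt ENNReal.toReal_nonneg, ENNReal.ofReal_toReal htop]
  have hZ0 : ‖Z 0‖ ≤ G :=
    DelayPredictor.norm_le_sqrt_toReal htop (le_add_right (le_add_right le_rfl))
  have hw0 : ‖Z 0 - S.Zhat U ξ 0‖ ≤ G :=
    DelayPredictor.norm_le_sqrt_toReal htop (le_add_right (le_add_left le_rfl))
  have hU0 : ∀ τ ∈ Icc (S.φ₁ 0) 0, ‖U τ‖ ≤ G := fun τ hτ =>
    DelayPredictor.norm_le_sqrt_toReal htop (le_add_left
      (le_iSup₂ (f := fun τ (_ : τ ∈ Icc (S.φ₁ 0) 0) => ‖U τ‖ₑ ^ 2) τ hτ))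
  have hZ : ∀ t ≥ 0, ‖Z t‖ ≤ Mz * Real.exp (-c * t) * G := fun t ht =>
    (hplant Z Y U ξ h G hZ0 hw0 hU0 t ht).trans (by gcongr; exact min_le_left _ _)
  have hw : ∀ t ≥ 0, ‖Z t - S.Zhat U ξ t‖ ≤ Mw * Real.exp (-c * t) * G := fun t ht =>
    (herr Z Y U ξ h t ht).trans (by gcongr; exact min_le_right _ _)
  have hU := hinput Z Y U ξ h G hG hZ hw hU0 t ht
  rw [hGsq, ← ENNReal.ofReal_mul (by positivity)]
  have hexp : Real.exp (-(2 * c) * t) = Real.exp (-c * t) ^ 2 := by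
    rw [← Real.exp_nat_mul]; congr 1; push_cast; ring
  have hsum : (Mz ^ 2 + Mw ^ 2 + Mu ^ 2) * Real.exp (-(2 * c) * t) * G ^ 2 =
      (Mz * Real.exp (-c * t) * G) ^ 2 + (Mw * Real.exp (-c * t) * G) ^ 2 +
        (Mu * Real.exp (-c * t) * G) ^ 2 := by
    rw [hexp]; ring
  rw [hsum, ENNReal.ofReal_add (by positivity) (by positivity),
    ENNReal.ofReal_add (by positivity) (by positivity)]
  exact add_le_add (add_le_add (DelayPredictor.enorm_sq_le_ofReal_sq (hZ t ht))
    (DelayPredictor.enorm_sq_le_ofReal_sq (hw t ht)))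
    (iSup₂_le fun τ hτ => DelayPredictor.enorm_sq_le_ofReal_sq (hU τ hτ))
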